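/- Let $L^2[0,1]$ be the real Hilbert space of square-integrable functions on $[0,1]$, with identity operator $I$. Let $A:[0,1]^2\to[-1,1]$ be a graphon, i.e. a symmetric Lebesgue measurable function, regarded also as the bounded operator $[A v](x)=\int_0^1 A(x,y)v(y)\,dy$ on $L^2[0,1]$. Let $$A(x,y)=\sum_{\ell\in I_\lambda}\lambda_\ell f_\ell(x)f_\ell(y)$$ be a spectral decomposition of $A$, convergent in $L^2([0,1]^2)$, where $I_\lambda$ indexes the nonzero eigenvalues $\lambda_\ell$ of $A$ (with multiplicity; $I_\lambda$ is countable, possibly finite or empty) and $(f_\ell)_{\ell\in I_\lambda}$ are corresponding orthonormal eigenfunctions, $A f_\ell=\lambda_\ell f_\ell$. Write $f_\ell f_\ell^{\mathsf T}$ for the operator $v\mapsto\langle f_\ell,v\rangle f_\ell$. For bounded operators $\mathbb A,\mathbb B$ on $L^2[0,1]$ and $T>0$, the controllability Gramian operator of the system $\dot x_t=\mathbb A x_t+\mathbb B u_t$, denoted $(\mathbb A;\mathbb B)$, is $$W_T=\int_0^T e^{\mathbb A(T-s)}\,\mathbb B\,\mathbb B^{\mathsf T}\,e^{\mathbb A^{\mathsf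 T}(T-s)}\,ds .$$ Then for every $T>0$ the graphon system $(A;I)$ has the following properties. 1) Its controllability Gramian operator is $$W_T=T\,I+\sum_{\ell\in I_\lambda}\left(\frac{e^{2\lambda_\ell T}-1}{2\lambda_\ell}-T\right)f_\ell f_\ell^{\mathsf T}.$$ 2) $W_T$ is invertible in the algebra of bounded operators on $L^2[0,1]$, and $$W_T^{-1}=\frac1T\,I-\frac1T\sum_{\ell\in I_\lambda}\frac{\frac{e^{2\lambda_\ell T}-1}{2\lambda_\ell}-T}{\frac{e^{2\lambda_\ell T}-1}{2\lambda_\ell}}\;f_\ell f_\ell^{\mathsf T}.$$ Both series converge unconditionally in operator norm. -/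

import Mathlib

open MeasureTheory Filter Topology

/-- The real Hilbert space `L²[0,1]`, for Lebesgue measure on `[0,1]`. -/
abbrev L2I : Type := Lp ℝ 2 (volume : Measure unitInterval)

/-- A graphon: a symmetric Lebesgue measurable function `[0,1]² → [-1,1]`.
For real functions, Lebesgue measurability is almost everywhere measurability with respect to
the Borel σ-algebra and Lebesgue measure. -/
structure Graphon where
  toFun : unitInterval → unitInterval → ℝ
  aemeasurable : AEMeasurable (fun p : unitInterval × unitInterval => toFun p.1 p.2) volume
  symm : ∀ x y, toFun x y = toFun y x
  bound : ∀ x y, toFun x y ∈ Set.Icc (-1 : ℝ) 1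

namespace Graphon

/-- The function `x ↦ ∫₀¹ W(x, y) v(y) dy`. -/
noncomputable def integralFun (W : Graphon) (v : L2I) (x : unitInterval) : ℝ :=
  ∫ y, W.toFun x y * v y

theorem norm_toFun_le (W : Graphon) (x y : unitInterval) : ‖W.toFun x y‖ ≤ 1 :=
  abs_le.2 (W.bound x y)

theorem integrable_coe (v : L2I) : Integrable (v : unitInterval → ℝ) volume :=
  (Lp.memLp v).integrable (by norm_num)

theorem ae_integrable (W : Graphon) (v : L2I) :
    ∀ᵐ x : unitInterval, Integrable (fun y => W.toFun x y * v y) volume := by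
  have h : AEStronglyMeasurable (fun p : unitInterval × unitInterval => W.toFun p.1 p.2)
      ((volume : Measure unitInterval).prod volume) := W.aemeasurable.aestronglyMeasurable
  filter_upwards [h.prodMk_left] with x hx
  exact (integrable_coe v).bdd_mul (c := 1) hx (ae_of_all _ fun y => W.norm_toFun_le x y)

theorem norm_integralFun_le (W : Graphon) (v : L2I) (x : unitInterval) :
    ‖W.integralFun v x‖ ≤ ‖v‖ := by
  have h1 : ‖W.integralFun v x‖ ≤ ∫ y, ‖v y‖ := by
    refine norm_integral_le_of_norm_le (integrable_coe v).norm (ae_of_all _ fun y => ?_)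
    rw [norm_mul]
    exact mul_le_of_le_one_left (norm_nonneg _) (W.norm_toFun_le x y)
  refine h1.trans ?_
  rw [integral_norm_eq_lintegral_enorm (Lp.aestronglyMeasurable v), ← eLpNorm_one_eq_lintegral_enorm,
    Lp.norm_def]
  exact ENNReal.toReal_mono (Lp.eLpNorm_ne_top v)
    (eLpNorm_le_eLpNorm_of_exponent_le (by norm_num) (Lp.aestronglyMeasurable v))

theorem memLp_integralFun (W : Graphon) (v : L2I) : MemLp (W.integralFun v) 2 volume := by
  refine MemLp.of_bound ?_ ‖v‖ (ae_of_all _ (W.norm_integralFun_le v))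
  have h : AEStronglyMeasurable
      (fun p : unitInterval × unitInterval => W.toFun p.1 p.2 * v p.2)
      ((volume : Measure unitInterval).prod volume) :=
    W.aemeasurable.aestronglyMeasurable.mul (Lp.aestronglyMeasurable v).comp_snd
  exact h.integral_prod_right'

/-- A graphon as a bounded operator on `L²[0,1]`: `[W v](x) = ∫₀¹ W(x, y) v(y) dy`. -/
noncomputable def op (W : Graphon) : L2I →L[ℝ] L2I :=
  LinearMap.mkContinuous
    { toFun := fun v => (W.memLp_integralFun v).toLp (W.integralFun v)
      map_add' := by
        intro u v
        rw [← MemLp.toLp_add, MemLp.toLp_eq_toLp_iff]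
        filter_upwards [W.ae_integrable u, W.ae_integrable v] with x hu hv
        simp only [integralFun, Pi.add_apply]
        rw [← integral_add hu hv]
        refine integral_congr_ae ?_
        filter_upwards [Lp.coeFn_add u v] with y hy
        rw [hy, Pi.add_apply, mul_add]
      map_smul' := by
        intro c v
        rw [RingHom.id_apply, ← MemLp.toLp_const_smul, MemLp.toLp_eq_toLp_iff]
        refine ae_of_all _ fun x => ?_
        simp only [integralFun, Pi.smul_apply]
        rw [← integral_smul]
        refine integral_congr_ae ?_
        filter_upwards [Lp.coeFn_smul c v] with y hy
        rw [hy, Pi.smul_apply, smul_eq_mul, smul_eq_mul]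
        ring }
    1 (by
      intro v
      rw [one_mul]
      refine (Lp.norm_le_of_ae_bound (C := ‖v‖) (norm_nonneg v) ?_).trans
        (by simp [measureUnivNNReal])
      filter_upwards [(W.memLp_integralFun v).coeFn_toLp] with x hx
      exact (congrArg norm hx).le.trans (W.norm_integralFun_le v x))

/-- The spectral decomposition `W(x, y) = ∑ lam ℓ * f ℓ x * f ℓ y` of a graphon, in the
`L²([0,1]²)` sense. The index type enumerates the nonzero eigenvalues with multiplicity, and the
`f ℓ` are corresponding orthonormal eigenfunctions. -/
structure IsSpectralDecomposition (W : Graphon) {ι : Type*} (lam : ι → ℝ) (f : ι → L2I) :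
    Prop where
  ne_zero : ∀ ℓ, lam ℓ ≠ 0
  orthonormal : Orthonormal ℝ f
  eigen : ∀ ℓ, W.op (f ℓ) = lam ℓ • f ℓ
  expansion : Tendsto
    (fun s : Finset ι =>
      eLpNorm (fun p : unitInterval × unitInterval =>
        W.toFun p.1 p.2 - ∑ ℓ ∈ s, lam ℓ * f ℓ p.1 * f ℓ p.2) 2 volume)
    atTop (𝓝 0)

end Graphon

/-- The controllability Gramian operator
`∫₀ᵀ e^{𝔸(T-s)} 𝔹 𝔹ᵀ e^{𝔸ᵀ(T-s)} ds` of the system `ẋ = 𝔸 x + 𝔹 u` on `L²[0,1]`, as an integral in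
the Banach space of bounded operators. -/
noncomputable def controllabilityGramian (𝔸 𝔹 : L2I →L[ℝ] L2I) (T : ℝ) : L2I →L[ℝ] L2I :=
  ∫ s in (0 : ℝ)..T,
    NormedSpace.exp ((T - s) • 𝔸) * 𝔹 * ContinuousLinearMap.adjoint 𝔹 *
      NormedSpace.exp ((T - s) • ContinuousLinearMap.adjoint 𝔸)

/-- The rank-one operator `f fᵀ : v ↦ ⟨f, v⟩ f`. -/
noncomputable def rankOneProj (f : L2I) : L2I →L[ℝ] L2I := InnerProductSpace.rankOne ℝ f f

open scoped InnerProductSpace ENNReal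

/-! The Hilbert-Schmidt norm dominates the operator norm, so the `L²` expansion of the kernel is
also an operator-norm expansion (`hasSum_op`). Hence the operator is self-adjoint, its eigenvalues
tend to 0, and it vanishes on the orthogonal complement of the `f ℓ`. The Gramian is therefore
diagonal: on `f ℓ` it is `g ℓ = ∫₀ᵀ e^{2 λ_ℓ (T-s)} ds`, on the complement it is `T`.

Since `g ℓ → T`, the coefficients `g ℓ - T` and `(g ℓ - T) / g ℓ` tend to 0, which suffices for norm
convergence of a diagonal series. The inverse must be `1 / g ℓ` on `f ℓ` and `1 / T` on the
complement. All final operator identities are checked on these two pieces, by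
`ContinuousLinearMap.ext_of_orthogonal`. -/

theorem rankOneProj_apply (f v : L2I) : rankOneProj f v = ⟪f, v⟫_ℝ • f :=
  InnerProductSpace.rankOne_apply f f v

theorem isSelfAdjoint_rankOneProj (f : L2I) : IsSelfAdjoint (rankOneProj f) := by
  rw [ContinuousLinearMap.isSelfAdjoint_iff_isSymmetric]
  intro u v
  simp only [ContinuousLinearMap.coe_coe, rankOneProj_apply, inner_smul_left, inner_smul_right,
    RCLike.conj_to_real]
  rw [real_inner_comm f u]
  ring

theorem sum_smul_rankOneProj_apply {ι : Type*} (f : ι → L2I) (c : ι → ℝ) (s : Finset ι) (v : L2I) :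
    (∑ ℓ ∈ s, c ℓ • rankOneProj (f ℓ)) v = ∑ ℓ ∈ s, (c ℓ * ⟪f ℓ, v⟫_ℝ) • f ℓ := by
  simp [rankOneProj_apply, smul_smul]

/-- Pythagoras and Bessel: the norm is controlled by the largest coefficient, not by the sum of the
coefficients. -/
theorem Orthonormal.norm_sum_smul_rankOneProj_le {ι : Type*} {f : ι → L2I} (hf : Orthonormal ℝ f)
    {c : ι → ℝ} {s : Finset ι} {ε : ℝ} (hε : 0 ≤ ε) (hc : ∀ ℓ ∈ s, |c ℓ| ≤ ε) :
    ‖∑ ℓ ∈ s, c ℓ • rankOneProj (f ℓ)‖ ≤ ε := by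
  refine ContinuousLinearMap.opNorm_le_bound _ hε fun v => ?_
  refine abs_le_of_sq_le_sq' ?_ (by positivity) |>.2
  rw [sum_smul_rankOneProj_apply, ← real_inner_self_eq_norm_sq, hf.inner_sum, mul_pow]
  calc ∑ ℓ ∈ s, (starRingEnd ℝ) (c ℓ * ⟪f ℓ, v⟫_ℝ) * (c ℓ * ⟪f ℓ, v⟫_ℝ)
      ≤ ∑ ℓ ∈ s, ε ^ 2 * ‖⟪f ℓ, v⟫_ℝ‖ ^ 2 := by
        refine Finset.sum_le_sum fun ℓ hℓ => ?_
        rw [RCLike.conj_to_real, ← pow_two, mul_pow, Real.norm_eq_abs, sq_abs, ← sq_abs (c ℓ)]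
        gcongr
        exact hc ℓ hℓ
    _ ≤ ε ^ 2 * ‖v‖ ^ 2 := by
        rw [← Finset.mul_sum]
        gcongr
        exact hf.sum_inner_products_le v

/-- A diagonal series in an orthonormal system converges unconditionally in operator norm as soon
as its coefficients tend to zero. -/
theorem Orthonormal.summable_smul_rankOneProj {ι : Type*} {f : ι → L2I} (hf : Orthonormal ℝ f)
    {c : ι → ℝ} (hc : Tendsto c cofinite (𝓝 0)) :
    Summable (fun ℓ => c ℓ • rankOneProj (f ℓ)) := by
  rw [summable_iff_vanishing_norm]
  intro ε hε
  have h : {ℓ | ¬ |c ℓ| < ε / 2}.Finite := by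
    have := hc.eventually (Metric.ball_mem_nhds (0 : ℝ) (half_pos hε))
    simpa [Filter.eventually_cofinite] using this
  refine ⟨h.toFinset, fun t ht => ?_⟩
  refine (hf.norm_sum_smul_rankOneProj_le (half_pos hε).le fun ℓ hℓ => ?_).trans_lt
    (half_lt_self hε)
  by_contra hcon
  exact Finset.disjoint_left.1 ht hℓ (h.mem_toFinset.2 fun h' => hcon (le_of_lt h'))

theorem Orthonormal.tsum_smul_rankOneProj_apply_self {ι : Type*} {f : ι → L2I}
    (hf : Orthonormal ℝ f) {c : ι → ℝ} (hc : Summable (fun ℓ => c ℓ • rankOneProj (f ℓ))) (m : ι) :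
    (∑' ℓ, c ℓ • rankOneProj (f ℓ)) (f m) = c m • f m := by
  classical
  have h := hc.hasSum.mapL (ContinuousLinearMap.apply ℝ L2I (f m))
  refine h.unique ?_
  have h' := hasSum_single (f := fun ℓ =>
    ContinuousLinearMap.apply ℝ L2I (f m) (c ℓ • rankOneProj (f ℓ))) m (fun ℓ hℓ => by
      simp [rankOneProj_apply, hf.inner_eq_zero hℓ])
  have hm : ContinuousLinearMap.apply ℝ L2I (f m) (c m • rankOneProj (f m)) = c m • f m := by
    simp [rankOneProj_apply, hf.norm_eq_one]
  rwa [hm] at h'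

theorem tsum_smul_rankOneProj_apply_of_orthogonal {ι : Type*} {f : ι → L2I} {c : ι → ℝ}
    (hc : Summable (fun ℓ => c ℓ • rankOneProj (f ℓ))) {v : L2I} (hv : ∀ ℓ, ⟪f ℓ, v⟫_ℝ = 0) :
    (∑' ℓ, c ℓ • rankOneProj (f ℓ)) v = 0 := by
  have h := hc.hasSum.mapL (ContinuousLinearMap.apply ℝ L2I v)
  refine h.unique ?_
  simp [rankOneProj_apply, hv, hasSum_zero]

/-- Two bounded operators agree if they agree on a family and on its orthogonal complement. -/
theorem ContinuousLinearMap.ext_of_orthogonal {ι : Type*} {f : ι → L2I} {S S' : L2I →L[ℝ] L2I}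
    (h : ∀ ℓ, S (f ℓ) = S' (f ℓ)) (h' : ∀ v, (∀ ℓ, ⟪f ℓ, v⟫_ℝ = 0) → S v = S' v) : S = S' := by
  -- The closure makes `K` complete, so every vector splits along `K` and its orthogonal complement.
  let K : Submodule ℝ L2I := (Submodule.span ℝ (Set.range f)).topologicalClosure
  have : CompleteSpace K := (Submodule.isClosed_topologicalClosure _).completeSpace_coe
  have hK : ∀ v ∈ K, S v = S' v := by
    have hle : K ≤ LinearMap.eqLocus (S : L2I →ₗ[ℝ] L2I) (S' : L2I →ₗ[ℝ] L2I) := by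
      refine Submodule.topologicalClosure_minimal _ (Submodule.span_le.2 ?_)
        (isClosed_eq S.continuous S'.continuous)
      rintro _ ⟨ℓ, rfl⟩
      exact h ℓ
    exact fun v hv => hle hv
  ext1 v
  obtain ⟨y, hy, z, hz, rfl⟩ := K.exists_add_mem_mem_orthogonal v
  rw [map_add, map_add, hK y hy, h' z fun ℓ => hz _
    (Submodule.le_topologicalClosure _ (Submodule.subset_span ⟨ℓ, rfl⟩))]

/-! ### Exponentials and the Gramian on eigenvectors -/

theorem exp_apply_of_apply_eq_smul {S : L2I →L[ℝ] L2I} {v : L2I} {μ : ℝ} (h : S v = μ • v) :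
    NormedSpace.exp S v = Real.exp μ • v := by
  have hpow : ∀ n : ℕ, (S ^ n) v = μ ^ n • v := by
    intro n
    induction n with
    | zero => simp
    | succ n ih =>
      rw [pow_succ', mul_apply_eq_comp, ih, map_smul, h, smul_smul, pow_succ]
  have h1 := (NormedSpace.exp_series_hasSum_exp' (𝕂 := ℝ) S).mapL
    (ContinuousLinearMap.apply ℝ L2I v)
  have h2 := (NormedSpace.exp_series_hasSum_exp' (𝕂 := ℝ) μ).smul_const v
  rw [← Real.exp_eq_exp_ℝ] at h2
  refine h1.unique ?_
  convert h2 using 2 with n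
  simp [hpow, smul_smul]

theorem integral_exp_sub_mul_sq {μ T : ℝ} (hμ : μ ≠ 0) :
    ∫ s in (0 : ℝ)..T, Real.exp ((T - s) * μ) * Real.exp ((T - s) * μ) =
      (Real.exp (2 * μ * T) - 1) / (2 * μ) := by
  have hd : ∀ s ∈ Set.uIcc 0 T, HasDerivAt (fun s => -Real.exp ((T - s) * μ * 2) / (2 * μ))
      (Real.exp ((T - s) * μ) * Real.exp ((T - s) * μ)) s := by
    intro s _
    have h1 : HasDerivAt (fun s => (T - s) * μ * 2) (-1 * μ * 2) s :=
      (((hasDerivAt_id s).const_sub T).mul_const μ).mul_const 2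
    refine (h1.exp.neg.div_const (2 * μ)).congr_deriv ?_
    rw [← Real.exp_add, ← mul_two]
    field_simp
  rw [intervalIntegral.integral_eq_sub_of_hasDerivAt hd
    (Continuous.intervalIntegrable (by fun_prop) _ _)]
  simp only [sub_self, zero_mul, Real.exp_zero, sub_zero]
  ring_nf

/-- The Gramian of a self-adjoint system with full control acts on an eigenvector of the system
by a scalar. -/
theorem controllabilityGramian_one_apply {S : L2I →L[ℝ] L2I} (hS : IsSelfAdjoint S) {v : L2I}
    {μ : ℝ} (h : S v = μ • v) (T : ℝ) :
    controllabilityGramian S 1 T v =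
      (∫ s in (0 : ℝ)..T, Real.exp ((T - s) * μ) * Real.exp ((T - s) * μ)) • v := by
  have hadj : ContinuousLinearMap.adjoint S = S := hS
  have hone : ContinuousLinearMap.adjoint (1 : L2I →L[ℝ] L2I) = 1 :=
    IsSelfAdjoint.one (L2I →L[ℝ] L2I)
  let : NormedAlgebra ℚ (L2I →L[ℝ] L2I) := NormedAlgebra.restrictScalars ℚ ℝ _
  have hcont : Continuous fun s : ℝ => NormedSpace.exp ((T - s) • S) :=
    NormedSpace.exp_continuous.comp (by fun_prop)
  have hint : IntervalIntegrable
      (fun s : ℝ => NormedSpace.exp ((T - s) • S) * NormedSpace.exp ((T - s) • S)) volume 0 T :=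
    (hcont.mul hcont).intervalIntegrable _ _
  rw [controllabilityGramian, hadj, hone]
  simp only [mul_one]
  rw [ContinuousLinearMap.intervalIntegral_apply hint,
    ← intervalIntegral.integral_smul_const]
  congr 1
  ext1 s
  have hs : ((T - s) • S) v = ((T - s) * μ) • v := by
    rw [smul_apply, h, smul_smul]
  rw [mul_apply_eq_comp, exp_apply_of_apply_eq_smul hs, map_smul,
    exp_apply_of_apply_eq_smul hs, smul_smul]

/-- This is half the difference quotient of `x ↦ e^{2xT}` at 0. The punctured neighbourhood matters:
at `x = 0` the quotient is `0 / 0 = 0`. -/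
theorem tendsto_exp_sub_one_div (T : ℝ) :
    Tendsto (fun x : ℝ => (Real.exp (2 * x * T) - 1) / (2 * x)) (𝓝[≠] 0) (𝓝 T) := by
  have h1 : HasDerivAt (fun x : ℝ => 2 * x * T) (2 * 1 * T) 0 :=
    ((hasDerivAt_id (0 : ℝ)).const_mul 2).mul_const T
  have h := (h1.exp.tendsto_slope).div_const 2
  have hT : Real.exp (2 * 0 * T) * (2 * 1 * T) / 2 = T := by simp
  rw [hT] at h
  refine h.congr fun x => ?_
  rw [slope_def_field]
  simp
  ring

theorem exp_sub_one_div_pos {μ T : ℝ} (hT : 0 < T) (hμ : μ ≠ 0) :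
    0 < (Real.exp (2 * μ * T) - 1) / (2 * μ) := by
  rcases hμ.lt_or_gt with h | h
  · refine div_pos_of_neg_of_neg (sub_neg.2 (Real.exp_lt_one_iff.2 ?_)) (by linarith)
    exact mul_neg_of_neg_of_pos (by linarith) hT
  · exact div_pos (sub_pos.2 (Real.one_lt_exp_iff.2 (by positivity))) (by linarith)

/-! ### From kernel convergence to operator-norm convergence -/

/-- An integral operator is bounded on `L²` by the Hilbert-Schmidt norm of its kernel. -/
theorem eLpNorm_integral_mul_le {K : unitInterval × unitInterval → ℝ}
    (hK : AEStronglyMeasurable K volume) {v : unitInterval → ℝ}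
    (hv : AEStronglyMeasurable v volume) :
    eLpNorm (fun x => ∫ y, K (x, y) * v y) 2 volume ≤
      eLpNorm K 2 volume * eLpNorm v 2 volume := by
  have hK' : AEStronglyMeasurable K ((volume : Measure unitInterval).prod volume) := hK
  -- Cauchy-Schwarz in `y` for almost every `x`; Tonelli then integrates the bound over `x`.
  have key : ∀ᵐ x : unitInterval, ‖∫ y, K (x, y) * v y‖ₑ ^ (2 : ℝ) ≤
      (∫⁻ y, ‖K (x, y)‖ₑ ^ (2 : ℝ)) * ∫⁻ y, ‖v y‖ₑ ^ (2 : ℝ) := by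
    filter_upwards [hK'.prodMk_left] with x hx
    have h1 : ‖∫ y, K (x, y) * v y‖ₑ ≤ ∫⁻ y, ‖K (x, y)‖ₑ * ‖v y‖ₑ := by
      refine (enorm_integral_le_lintegral_enorm _).trans_eq ?_
      simp only [enorm_mul]
    have h2 := h1.trans (ENNReal.lintegral_mul_le_Lp_mul_Lq volume Real.HolderConjugate.two_two
      hx.enorm hv.enorm)
    refine (ENNReal.rpow_le_rpow h2 (by norm_num : (0 : ℝ) ≤ 2)).trans_eq ?_
    rw [ENNReal.mul_rpow_of_nonneg _ _ (by norm_num), ← ENNReal.rpow_mul, ← ENNReal.rpow_mul]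
    norm_num
  have h2 : ((2 : ℝ≥0∞)).toReal = 2 := by norm_num
  rw [eLpNorm_eq_lintegral_rpow_enorm_toReal (by norm_num) (by norm_num),
    eLpNorm_eq_lintegral_rpow_enorm_toReal (by norm_num) (by norm_num),
    eLpNorm_eq_lintegral_rpow_enorm_toReal (by norm_num) (by norm_num), h2,
    ← ENNReal.mul_rpow_of_nonneg _ _ (by norm_num)]
  refine ENNReal.rpow_le_rpow ?_ (by norm_num)
  refine (lintegral_mono_ae key).trans ?_
  have hm : AEMeasurable (fun p : unitInterval × unitInterval => ‖K p‖ₑ ^ (2 : ℝ))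
      ((volume : Measure unitInterval).prod volume) := hK'.enorm.pow_const 2
  rw [lintegral_mul_const'' _ hm.lintegral_prod_right', Measure.volume_eq_prod,
    lintegral_prod _ hm]

namespace Graphon

theorem op_coeFn (W : Graphon) (v : L2I) : W.op v =ᵐ[volume] W.integralFun v :=
  (W.memLp_integralFun v).coeFn_toLp

/-- The operator norm distance of a graphon to a finite-rank operator is at most the `L²`
distance of the kernels. -/
theorem enorm_op_sub_sum_apply_le (W : Graphon) {ι : Type*} (lam : ι → ℝ) (f : ι → L2I)
    (s : Finset ι) (v : L2I) :
    ‖(W.op - ∑ ℓ ∈ s, lam ℓ • rankOneProj (f ℓ)) v‖ₑ ≤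
      eLpNorm (fun p : unitInterval × unitInterval =>
        W.toFun p.1 p.2 - ∑ ℓ ∈ s, lam ℓ * f ℓ p.1 * f ℓ p.2) 2 volume * ‖v‖ₑ := by
  have hmeas : AEStronglyMeasurable (fun p : unitInterval × unitInterval =>
      W.toFun p.1 p.2 - ∑ ℓ ∈ s, lam ℓ * f ℓ p.1 * f ℓ p.2)
      ((volume : Measure unitInterval).prod volume) := by
    refine W.aemeasurable.aestronglyMeasurable.sub ?_
    refine Finset.aestronglyMeasurable_fun_sum _ fun ℓ _ => ?_
    exact ((Lp.aestronglyMeasurable (f ℓ)).comp_fst.const_mul _).mul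
      (Lp.aestronglyMeasurable (f ℓ)).comp_snd
  have hfv : ∀ ℓ, Integrable (fun y => f ℓ y * v y) volume := fun ℓ =>
    (Lp.memLp (f ℓ)).integrable_mul (Lp.memLp v)
  have hinner : ∀ ℓ, ⟪f ℓ, v⟫_ℝ = ∫ y, f ℓ y * v y := by
    intro ℓ
    rw [L2.inner_def]
    simp [mul_comm]
  rw [Lp.enorm_def, Lp.enorm_def]
  refine le_trans (le_of_eq (eLpNorm_congr_ae ?_))
    (eLpNorm_integral_mul_le hmeas (Lp.aestronglyMeasurable v))
  have hsum : ((∑ ℓ ∈ s, (lam ℓ * ⟪f ℓ, v⟫_ℝ) • f ℓ : L2I) : unitInterval → ℝ) =ᵐ[volume]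
      fun x => ∑ ℓ ∈ s, (lam ℓ * ⟪f ℓ, v⟫_ℝ) * f ℓ x := by
    have h1 : ∀ᵐ x, ∀ ℓ ∈ s, ((lam ℓ * ⟪f ℓ, v⟫_ℝ) • f ℓ : L2I) x =
        (lam ℓ * ⟪f ℓ, v⟫_ℝ) * f ℓ x :=
      (Finset.eventually_all s).2 fun ℓ _ => Lp.coeFn_smul _ _
    filter_upwards [Lp.coeFn_finsetSum s fun ℓ => (lam ℓ * ⟪f ℓ, v⟫_ℝ) • f ℓ, h1] with x hx hx1
    rw [hx, Finset.sum_apply]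
    exact Finset.sum_congr rfl hx1
  rw [sub_apply, sum_smul_rankOneProj_apply]
  filter_upwards [Lp.coeFn_sub (W.op v) (∑ ℓ ∈ s, (lam ℓ * ⟪f ℓ, v⟫_ℝ) • f ℓ), W.op_coeFn v, hsum,
    W.ae_integrable v] with x hx hx1 hx2 hx3
  rw [hx, Pi.sub_apply, hx1, hx2, integralFun]
  have hi : ∀ ℓ ∈ s, Integrable (fun y => lam ℓ * f ℓ x * (f ℓ y * v y)) volume :=
    fun ℓ _ => (hfv ℓ).const_mul _
  simp only [sub_mul, Finset.sum_mul, mul_assoc _ _ (v _)]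
  rw [integral_sub hx3 (by simpa only [mul_assoc] using integrable_finsetSum s hi),
    integral_finsetSum _ hi]
  congr 1
  refine Finset.sum_congr rfl fun ℓ _ => ?_
  rw [integral_const_mul, hinner]
  ring

namespace IsSpectralDecomposition

variable {W : Graphon} {ι : Type*} {lam : ι → ℝ} {f : ι → L2I}

theorem hasSum_op (h : W.IsSpectralDecomposition lam f) :
    HasSum (fun ℓ => lam ℓ • rankOneProj (f ℓ)) W.op := by
  rw [HasSum, SummationFilter.unconditional_filter, tendsto_iff_norm_sub_tendsto_zero]
  have hlim := (ENNReal.tendsto_toReal ENNReal.zero_ne_top).comp h.expansion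
  rw [ENNReal.toReal_zero] at hlim
  -- Finiteness is needed before passing to reals, because `toReal` sends `∞` to 0.
  have hfin := h.expansion.eventually (gt_mem_nhds ENNReal.zero_lt_top)
  refine squeeze_zero' (Eventually.of_forall fun _ => norm_nonneg _) ?_ hlim
  filter_upwards [hfin] with s hs
  rw [norm_sub_rev]
  refine ContinuousLinearMap.opNorm_le_bound _ ENNReal.toReal_nonneg fun v => ?_
  have hv := ENNReal.toReal_mono (ENNReal.mul_ne_top hs.ne enorm_ne_top)
    (W.enorm_op_sub_sum_apply_le lam f s v)
  rwa [ENNReal.toReal_mul, toReal_enorm, toReal_enorm] at hv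

/-- Taking adjoints is continuous and fixes each term of the expansion. -/
theorem isSelfAdjoint_op (h : W.IsSpectralDecomposition lam f) : IsSelfAdjoint W.op := by
  refine HasSum.unique ?_ h.hasSum_op
  convert h.hasSum_op.star using 2 with ℓ
  rw [star_smul, star_trivial, (isSelfAdjoint_rankOneProj (f ℓ)).star_eq]

/-- Each `|lam ℓ|` is at most the norm of its term, seen by applying the term to `f ℓ`, and the
terms of a summable family tend to 0. -/
theorem tendsto_eigenvalue (h : W.IsSpectralDecomposition lam f) :
    Tendsto lam cofinite (𝓝[≠] 0) := by
  refine tendsto_nhdsWithin_iff.2 ⟨?_, Eventually.of_forall h.ne_zero⟩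
  refine squeeze_zero_norm (fun ℓ => ?_) (tendsto_zero_iff_norm_tendsto_zero.1
    h.hasSum_op.summable.tendsto_cofinite_zero)
  have h1 : (lam ℓ • rankOneProj (f ℓ)) (f ℓ) = lam ℓ • f ℓ := by
    simp [rankOneProj_apply, h.orthonormal.norm_eq_one]
  have h2 := (lam ℓ • rankOneProj (f ℓ)).le_opNorm (f ℓ)
  rwa [h1, norm_smul, h.orthonormal.norm_eq_one, mul_one, mul_one] at h2

theorem op_apply_of_orthogonal (h : W.IsSpectralDecomposition lam f) {v : L2I}
    (hv : ∀ ℓ, ⟪f ℓ, v⟫_ℝ = 0) : W.op v = 0 := by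
  rw [← h.hasSum_op.tsum_eq]
  exact tsum_smul_rankOneProj_apply_of_orthogonal h.hasSum_op.summable hv

theorem tendsto_gramian_coeff (h : W.IsSpectralDecomposition lam f) (T : ℝ) :
    Tendsto (fun ℓ => (Real.exp (2 * lam ℓ * T) - 1) / (2 * lam ℓ)) cofinite (𝓝 T) :=
  (tendsto_exp_sub_one_div T).comp h.tendsto_eigenvalue

theorem controllabilityGramian_apply (h : W.IsSpectralDecomposition lam f) (T : ℝ) (ℓ : ι) :
    controllabilityGramian W.op 1 T (f ℓ) =
      ((Real.exp (2 * lam ℓ * T) - 1) / (2 * lam ℓ)) • f ℓ := by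
  rw [controllabilityGramian_one_apply h.isSelfAdjoint_op (h.eigen ℓ),
    integral_exp_sub_mul_sq (h.ne_zero ℓ)]

theorem controllabilityGramian_apply_of_orthogonal (h : W.IsSpectralDecomposition lam f) (T : ℝ)
    {v : L2I} (hv : ∀ ℓ, ⟪f ℓ, v⟫_ℝ = 0) : controllabilityGramian W.op 1 T v = T • v := by
  -- Such a `v` satisfies the eigenvector equation for the value 0, so the integrand is constantly
  -- 1.
  rw [controllabilityGramian_one_apply (μ := 0) h.isSelfAdjoint_op
    (by rw [h.op_apply_of_orthogonal hv, zero_smul])]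
  simp

end IsSpectralDecomposition

end Graphon

/-! ### The Gramian and its inverse -/

theorem mainTheorem7 (A : Graphon) {ι : Type*} (lam : ι → ℝ) (f : ι → L2I)
    (hA : A.IsSpectralDecomposition lam f) (T : ℝ) (hT : 0 < T) :
    (Summable (fun ℓ =>
        ((Real.exp (2 * lam ℓ * T) - 1) / (2 * lam ℓ) - T) • rankOneProj (f ℓ)) ∧
      controllabilityGramian A.op 1 T =
        T • (1 : L2I →L[ℝ] L2I) +
          ∑' ℓ, ((Real.exp (2 * lam ℓ * T) - 1) / (2 * lam ℓ) - T) • rankOneProj (f ℓ)) ∧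
    (IsUnit (controllabilityGramian A.op 1 T) ∧
      Summable (fun ℓ =>
        (((Real.exp (2 * lam ℓ * T) - 1) / (2 * lam ℓ) - T) /
          ((Real.exp (2 * lam ℓ * T) - 1) / (2 * lam ℓ))) • rankOneProj (f ℓ)) ∧
      Ring.inverse (controllabilityGramian A.op 1 T) =
        (1 / T) • (1 : L2I →L[ℝ] L2I) -
          (1 / T) • ∑' ℓ,
            (((Real.exp (2 * lam ℓ * T) - 1) / (2 * lam ℓ) - T) /
              ((Real.exp (2 * lam ℓ * T) - 1) / (2 * lam ℓ))) • rankOneProj (f ℓ)) := by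
  have hsum₁ := hA.orthonormal.summable_smul_rankOneProj
    (tendsto_sub_nhds_zero_iff.2 (hA.tendsto_gramian_coeff T))
  have hsum₂ := hA.orthonormal.summable_smul_rankOneProj
    (c := fun ℓ => ((Real.exp (2 * lam ℓ * T) - 1) / (2 * lam ℓ) - T) /
      ((Real.exp (2 * lam ℓ * T) - 1) / (2 * lam ℓ))) (by
        have h := (tendsto_sub_nhds_zero_iff.2 (hA.tendsto_gramian_coeff T)).div
          (hA.tendsto_gramian_coeff T) hT.ne'
        rwa [zero_div] at h)
  have hpos := fun ℓ => exp_sub_one_div_pos hT (hA.ne_zero ℓ)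
  have hself := hA.orthonormal.tsum_smul_rankOneProj_apply_self hsum₂
  have hort := fun v => tsum_smul_rankOneProj_apply_of_orthogonal hsum₂ (v := v)
  have hW := hA.controllabilityGramian_apply T
  have hW' := fun v => hA.controllabilityGramian_apply_of_orthogonal T (v := v)
  -- With `g` the Gramian coefficient, `1/T - (1/T) (g - T)/g = 1/g`: the proposed inverse has the
  -- reciprocal eigenvalues.
  have hscal : ∀ ℓ, (1 / T - 1 / T * (((Real.exp (2 * lam ℓ * T) - 1) / (2 * lam ℓ) - T) /
      ((Real.exp (2 * lam ℓ * T) - 1) / (2 * lam ℓ)))) *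
      ((Real.exp (2 * lam ℓ * T) - 1) / (2 * lam ℓ)) = 1 := by
    intro ℓ
    have h := (hpos ℓ).ne'
    generalize (Real.exp (2 * lam ℓ * T) - 1) / (2 * lam ℓ) = g at h ⊢
    field_simp
    ring
  set G := controllabilityGramian A.op 1 T
  set C : L2I →L[ℝ] L2I := (1 / T) • (1 : L2I →L[ℝ] L2I) -
    (1 / T) • ∑' ℓ, (((Real.exp (2 * lam ℓ * T) - 1) / (2 * lam ℓ) - T) /
      ((Real.exp (2 * lam ℓ * T) - 1) / (2 * lam ℓ))) • rankOneProj (f ℓ) with hC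
  have hCself : ∀ ℓ, C (f ℓ) =
      (1 / T - 1 / T * (((Real.exp (2 * lam ℓ * T) - 1) / (2 * lam ℓ) - T) /
        ((Real.exp (2 * lam ℓ * T) - 1) / (2 * lam ℓ)))) • f ℓ := by
    intro ℓ
    rw [hC, sub_apply, smul_apply,
      smul_apply, hself, smul_smul, sub_smul, one_apply_eq_self]
  have hCort : ∀ v, (∀ ℓ, ⟪f ℓ, v⟫_ℝ = 0) → C v = (1 / T) • v := by
    intro v hv
    rw [hC, sub_apply, smul_apply,
      smul_apply, hort v hv, smul_zero, sub_zero,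
      one_apply_eq_self]
  have hGC : G * C = 1 := by
    refine ContinuousLinearMap.ext_of_orthogonal (f := f) (fun ℓ => ?_) fun v hv => ?_
    · rw [mul_apply_eq_comp, hCself, map_smul, hW, smul_smul, hscal, one_smul,
        one_apply_eq_self]
    · rw [mul_apply_eq_comp, hCort v hv, map_smul, hW' v hv, smul_smul,
        one_div_mul_cancel hT.ne', one_smul, one_apply_eq_self]
  have hCG : C * G = 1 := by
    refine ContinuousLinearMap.ext_of_orthogonal (f := f) (fun ℓ => ?_) fun v hv => ?_
    · rw [mul_apply_eq_comp, hW, map_smul, hCself, smul_smul, mul_comm, hscal,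
        one_smul, one_apply_eq_self]
    · rw [mul_apply_eq_comp, hW' v hv, map_smul, hCort v hv, smul_smul,
        mul_one_div_cancel hT.ne', one_smul, one_apply_eq_self]
  refine ⟨⟨hsum₁, ?_⟩, ⟨⟨G, C, hGC, hCG⟩, rfl⟩, hsum₂,
    Ring.inverse_unit (⟨G, C, hGC, hCG⟩ : (L2I →L[ℝ] L2I)ˣ)⟩
  refine ContinuousLinearMap.ext_of_orthogonal (f := f) (fun ℓ => ?_) fun v hv => ?_
  · rw [hW, add_apply,
      hA.orthonormal.tsum_smul_rankOneProj_apply_self hsum₁, smul_apply,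
      one_apply_eq_self, ← add_smul, add_sub_cancel]
  · rw [hW' v hv, add_apply,
      tsum_smul_rankOneProj_apply_of_orthogonal hsum₁ hv, add_zero,
      smul_apply, one_apply_eq_self]
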